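/- For a finite poset $P$, let $c_k(P)$ be the number of $k$-element chains in $P$, let $n$ be the largest cardinality of a chain in $P$, and let $$h_P(x)=\sum_{i=0}^{n} c_i(P)\,x^i(1-x)^{n-i}$$ (the $h$-polynomial of the order complex of $P$). Call a real polynomial real-rooted if it is zero or all its complex roots are real. Let $M$ and $M'$ be finite matroids with lattices of flats $L$ and $L'$, respectively, ordered by inclusion. If $h_L(x)$ is real-rooted and $M'$ is obtained from $M$ by successively adding finitely many coloops, then $h_{L'}(x)$ is real-rooted as well. (Here $M'$ is obtained from $M$ by adding one coloop if $M'$ has a coloop $e$ whose deletion from $M'$ gives $M$.) -/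

import Mathlib

/-- The number `c_k(P)` of chains with exactly `k` elements in a finite poset `P`
(the empty chain is counted for `k = 0`). -/
noncomputable def chainCount (P : Type*) [PartialOrder P] (k : ℕ) : ℕ :=
  Nat.card {C : Finset P // IsChain (· ≤ ·) (C : Set P) ∧ C.card = k}

/-- The largest cardinality of a chain in a finite poset `P`. -/
noncomputable def maxChainCard (P : Type*) [PartialOrder P] : ℕ :=
  sSup {k : ℕ | ∃ C : Finset P, IsChain (· ≤ ·) (C : Set P) ∧ C.card = k}

/-- The `h`-polynomial `h_P(x)` of the order complex of a finite poset `P`: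
with `n` the largest cardinality of a chain,
`h_P(x) = ∑_{i=0}^{n} c_i(P) x^i (1 - x)^(n - i)`, that is, `(1 - x)^n p_P(x / (1 - x))`
where `p_P(x) = ∑_k c_k(P) x^k` is the chain polynomial. -/
noncomputable def hPolynomial (P : Type*) [PartialOrder P] : Polynomial ℝ :=
  ∑ i ∈ Finset.range (maxChainCard P + 1),
    Polynomial.C (chainCount P i : ℝ) * Polynomial.X ^ i *
      (1 - Polynomial.X) ^ (maxChainCard P - i)

/-- A polynomial with real coefficients is real-rooted if it is zero or all its complex roots
are real. -/
def RealRooted (f : Polynomial ℝ) : Prop :=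
  f = 0 ∨ ∀ z : ℂ, Polynomial.aeval z f = 0 → z.im = 0

/-- The lattice of flats of a matroid: its flats, ordered by inclusion (the order is the one
inherited from `Set α`). -/
abbrev LatticeOfFlats {α : Type*} (M : Matroid α) : Type _ :=
  {F : Set α // M.IsFlat F}

/-- `M'` is obtained from `M` by adding one coloop `e`: `e` is a coloop of `M'` and deleting it
from `M'` gives `M` (so `e` is not in the ground set of `M`). -/
def AddsColoop {α : Type*} (M M' : Matroid α) : Prop :=
  ∃ e : α, M'.IsColoop e ∧ M'.delete {e} = M

open Polynomial

/-! ### Chains by greatest element -/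

section ChainPolynomial

/-! For `x` in a finite poset let `T_x` count the chains with greatest element `x` by size. If `t`
is a top element, the chain polynomial `p` satisfies `X p = (1 + X) T_t`, so the substitution `z ↦ z
/ (1 - z)` makes `h` real-rooted exactly when `T_t` is. A coloop replaces `L` by `L × Bool`, and
there `T_(x, true) = X (1 + X) T_x'` (`topChainPolynomial_prod_bool_true`). Gauss–Lucas then shows
that real-rootedness survives. -/

open scoped Classical in
/-- The generating polynomial, by cardinality, of the chains of `P` with greatest element `x`. -/
noncomputable def topChainPolynomial {P : Type*} [PartialOrder P] [Fintype P] (x : P) : ℝ[X] :=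
  ∑ C ∈ Finset.univ.filter
    fun C : Finset P => IsChain (· ≤ ·) (C : Set P) ∧ IsGreatest (C : Set P) x, X ^ C.card

variable {P Q : Type*} [PartialOrder P] [Fintype P] [PartialOrder Q] [Fintype Q]

open scoped Classical in
theorem sum_chains_eq_one_add_sum_topChainPolynomial (S : Set P) (hS : IsLowerSet S) :
    ∑ C ∈ Finset.univ.filter
        fun C : Finset P => IsChain (· ≤ ·) (C : Set P) ∧ (C : Set P) ⊆ S, (X : ℝ[X]) ^ C.card =
      1 + ∑ z : P with z ∈ S, topChainPolynomial z := by
  simp only [topChainPolynomial]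
  rw [← Finset.sum_biUnion]
  · rw [← Finset.sum_erase_add _ _ (a := ∅) (by simp), add_comm (1 : ℝ[X])]
    congr 1
    · refine Finset.sum_congr ?_ fun _ _ => rfl
      ext C
      simp only [Finset.mem_erase, Finset.mem_filter, Finset.mem_univ, true_and,
        Finset.mem_biUnion]
      constructor
      · rintro ⟨hne, hC, hCS⟩
        obtain ⟨m, hm, hmax⟩ := C.exists_maximal (Finset.nonempty_iff_ne_empty.2 hne)
        refine ⟨m, hCS hm, hC, hm, fun y hy => ?_⟩
        rcases hC.total hy hm with h | h
        · exact h
        · exact hmax hy h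
      · rintro ⟨z, hz, hC, hg⟩
        refine ⟨?_, hC, fun y hy => hS (hg.2 hy) hz⟩
        rintro rfl
        simpa using hg.1
  · intro z _ z' _ hne
    refine Finset.disjoint_left.2 fun C hC hC' => hne ?_
    simp only [Finset.mem_filter] at hC hC'
    exact hC.2.2.unique hC'.2.2

-- Removing `x` leaves an arbitrary chain strictly below `x`; this recursion drives the inductions
-- that follow.
open scoped Classical in
theorem topChainPolynomial_eq (x : P) :
    topChainPolynomial x = X * (1 + ∑ z : P with z < x, topChainPolynomial z) := by
  have h := sum_chains_eq_one_add_sum_topChainPolynomial (Set.Iio x) (isLowerSet_Iio x)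
  simp only [Set.mem_Iio] at h
  rw [← h, topChainPolynomial, Finset.mul_sum]
  refine Finset.sum_bij' (fun C _ => C.erase x) (fun C _ => insert x C) ?_ ?_ ?_ ?_ ?_
  · intro C hC
    simp only [Finset.mem_filter, Finset.mem_univ, true_and] at hC ⊢
    refine ⟨hC.1.mono (by simp), fun y hy => ?_⟩
    simp only [Finset.coe_erase, Set.mem_sdiff, Set.mem_singleton_iff] at hy
    exact lt_of_le_of_ne (hC.2.2 hy.1) hy.2
  · intro C hC
    simp only [Finset.mem_filter, Finset.mem_univ, true_and] at hC ⊢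
    rw [Finset.coe_insert]
    refine ⟨hC.1.insert fun b hb _ => Or.inr (hC.2 hb).le, Set.mem_insert _ _, ?_⟩
    rintro y (rfl | hy)
    · exact le_rfl
    · exact (hC.2 hy).le
  · intro C hC
    simp only [Finset.mem_filter, Finset.mem_univ, true_and] at hC
    exact Finset.insert_erase hC.2.1
  · intro C hC
    simp only [Finset.mem_filter, Finset.mem_univ, true_and] at hC
    exact Finset.erase_insert fun hx => lt_irrefl _ (hC.2 hx)
  · intro C hC
    simp only [Finset.mem_filter, Finset.mem_univ, true_and] at hC
    rw [← pow_succ', Finset.card_erase_add_one hC.2.1]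

theorem topChainPolynomial_orderIso (e : P ≃o Q) (x : P) :
    topChainPolynomial (e x) = topChainPolynomial x := by
  classical
  induction x using WellFoundedLT.induction with
  | _ x ih =>
    rw [topChainPolynomial_eq, topChainPolynomial_eq x]
    congr 2
    rw [← Finset.sum_congr rfl fun z hz => ih z (Finset.mem_filter.1 hz).2]
    refine (Finset.sum_equiv e.toEquiv ?_ ?_).symm <;> simp

theorem topChainPolynomial_prod_bool_false (x : P) :
    topChainPolynomial (x, false) = topChainPolynomial x := by
  classical
  induction x using WellFoundedLT.induction with
  | _ x ih =>
    rw [topChainPolynomial_eq, topChainPolynomial_eq x,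
      ← Finset.sum_congr rfl fun z hz => ih z (Finset.mem_filter.1 hz).2]
    simp only [Finset.sum_filter, Fintype.sum_prod_type, Fintype.sum_bool]
    simp [Prod.lt_iff, show ¬(true ≤ false) by decide, show ¬(true < false) by decide]

/-- Below `(x, true)` lie `(z, true)` for `z < x` and `(z, false)` for `z ≤ x`. With `T_x = X S`,
induction gives `X (S + X S + X (1 + X) S')`, which is `X (1 + X) (X S)'`. -/
theorem topChainPolynomial_prod_bool_true (x : P) :
    topChainPolynomial (x, true) = X * (1 + X) * derivative (topChainPolynomial x) := by
  classical
  induction x using WellFoundedLT.induction with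
  | _ x ih =>
    have hsum : ∑ z : P × Bool with z < (x, true), topChainPolynomial z =
        ∑ z : P with z < x, topChainPolynomial (z, true) +
          (∑ z : P with z < x, topChainPolynomial z + topChainPolynomial x) := by
      have hle : ∑ z : P with z < x, topChainPolynomial z + topChainPolynomial x =
          ∑ z : P with z ≤ x, topChainPolynomial z := by
        rw [add_comm, ← Finset.sum_insert (by simp)]
        refine Finset.sum_congr ?_ fun _ _ => rfl
        ext z
        simp [le_iff_eq_or_lt]
      rw [hle]
      simp only [Finset.sum_filter, Fintype.sum_prod_type, Fintype.sum_bool,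
        Finset.sum_add_distrib, topChainPolynomial_prod_bool_false]
      simp [Prod.lt_iff, or_iff_right_of_imp le_of_lt]
    rw [topChainPolynomial_eq, hsum,
      Finset.sum_congr rfl fun z hz => ih z (Finset.mem_filter.1 hz).2, ← Finset.mul_sum,
      topChainPolynomial_eq x, ← derivative_sum]
    simp only [derivative_mul, derivative_X, derivative_add, derivative_one]
    ring

end ChainPolynomial

/-! ### From the `h`-polynomial to chains ending at the top -/

section HPolynomial

theorem aeval_hPolynomial {P : Type*} [PartialOrder P] (z : ℂ) (hz : 1 - z ≠ 0) :
    aeval z (hPolynomial P) = (1 - z) ^ maxChainCard P *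
      aeval (z / (1 - z))
        (∑ i ∈ Finset.range (maxChainCard P + 1), C (chainCount P i : ℝ) * X ^ i) := by
  simp only [hPolynomial, map_sum, map_mul, map_pow, map_sub, map_one, aeval_X, aeval_C,
    Finset.mul_sum]
  refine Finset.sum_congr rfl fun i hi => ?_
  obtain ⟨d, hd⟩ := Nat.exists_eq_add_of_le (Nat.lt_succ_iff.1 (Finset.mem_range.1 hi))
  rw [hd, Nat.add_sub_cancel_left, div_pow, pow_add]
  field_simp

variable {P : Type*} [PartialOrder P] [Fintype P]

theorem bddAbove_card_chains :
    BddAbove {k : ℕ | ∃ C : Finset P, IsChain (· ≤ ·) (C : Set P) ∧ C.card = k} :=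
  ⟨Fintype.card P, by rintro _ ⟨C, -, rfl⟩; exact C.card_le_univ⟩

theorem card_le_maxChainCard {C : Finset P} (hC : IsChain (· ≤ ·) (C : Set P)) :
    C.card ≤ maxChainCard P :=
  le_csSup bddAbove_card_chains ⟨C, hC, rfl⟩

theorem chainCount_maxChainCard_ne_zero : chainCount P (maxChainCard P) ≠ 0 := by
  obtain ⟨C, hC, hcard⟩ := Nat.sSup_mem
    (s := {k : ℕ | ∃ C : Finset P, IsChain (· ≤ ·) (C : Set P) ∧ C.card = k})
    ⟨0, ∅, by simp, by simp⟩ bddAbove_card_chains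
  have : Nonempty {C : Finset P // IsChain (· ≤ ·) (C : Set P) ∧ C.card = maxChainCard P} :=
    ⟨⟨C, hC, hcard⟩⟩
  exact Nat.card_pos.ne'

/-- Only the term of longest chains survives at 1. Hence no root sits at the pole of `z / (1 - z)`.
-/
theorem hPolynomial_eval_one_ne_zero : (hPolynomial P).eval 1 ≠ 0 := by
  rw [hPolynomial, eval_finsetSum, Finset.sum_eq_single (maxChainCard P)]
  · simpa using chainCount_maxChainCard_ne_zero
  · intro i hi hne
    have : maxChainCard P - i ≠ 0 := by
      have := Finset.mem_range.1 hi
      omega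
    simp [this]
  · simp

theorem sum_chainCount_mul_X_pow :
    ∑ i ∈ Finset.range (maxChainCard P + 1), C (chainCount P i : ℝ) * X ^ i =
      1 + ∑ z : P, topChainPolynomial z := by
  classical
  have h := sum_chains_eq_one_add_sum_topChainPolynomial (Set.univ : Set P) isLowerSet_univ
  simp only [Set.subset_univ, and_true, Set.mem_univ, Finset.filter_true] at h
  rw [← h, ← Finset.sum_fiberwise_of_maps_to (g := Finset.card)
    (t := Finset.range (maxChainCard P + 1))]
  · refine Finset.sum_congr rfl fun i _ => ?_
    rw [Finset.sum_congr rfl (g := fun _ => (X : ℝ[X]) ^ i)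
      fun C hC => by rw [(Finset.mem_filter.1 hC).2], Finset.sum_const, Finset.filter_filter,
      nsmul_eq_mul, chainCount, Nat.card_eq_fintype_card, Fintype.card_subtype]
    simp
  · intro C hC
    have := card_le_maxChainCard (Finset.mem_filter.1 hC).2
    simp only [Finset.mem_range]
    omega

theorem X_mul_sum_chainCount_mul_X_pow {t : P} (ht : IsTop t) :
    X * ∑ i ∈ Finset.range (maxChainCard P + 1), C (chainCount P i : ℝ) * X ^ i =
      (1 + X) * topChainPolynomial t := by
  classical
  have hsum : ∑ z : P, topChainPolynomial z =
      topChainPolynomial t + ∑ z : P with z < t, topChainPolynomial z := by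
    rw [← Finset.add_sum_erase _ _ (Finset.mem_univ t)]
    congr 1
    refine Finset.sum_congr ?_ fun _ _ => rfl
    ext z
    simp [lt_iff_le_and_ne, ht z]
  have h := topChainPolynomial_eq t
  rw [sum_chainCount_mul_X_pow, hsum]
  linear_combination -h

theorem Complex.im_eq_zero_iff_exists_ofReal {z : ℂ} : z.im = 0 ↔ ∃ r : ℝ, (r : ℂ) = z :=
  ⟨fun h => ⟨z.re, by apply Complex.ext <;> simp [h]⟩, by rintro ⟨r, rfl⟩; simp⟩

theorem topChainPolynomial_ne_zero (x : P) : topChainPolynomial x ≠ 0 := by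
  classical
  intro h
  have h1 := congrArg (eval 1) h
  simp only [topChainPolynomial, eval_finsetSum, eval_pow, eval_X, one_pow, Finset.sum_const,
    nsmul_eq_mul, mul_one, eval_zero, Nat.cast_eq_zero, Finset.card_eq_zero] at h1
  have : ({x} : Finset P) ∈ (∅ : Finset (Finset P)) := by
    rw [← h1]
    simp
  simp at this

/-- The inverse maps `z / (1 - z)` and `y / (1 + y)` have real coefficients and match the roots, up
to the real exceptions 0 and -1. -/
theorem realRooted_hPolynomial_iff {t : P} (ht : IsTop t) :
    RealRooted (hPolynomial P) ↔ RealRooted (topChainPolynomial t) := by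
  have hne : hPolynomial P ≠ 0 := fun h => hPolynomial_eval_one_ne_zero (P := P) (by simp [h])
  have key (y : ℂ) := congrArg (aeval y) (X_mul_sum_chainCount_mul_X_pow ht)
  simp only [map_mul, map_add, map_one, aeval_X] at key
  simp only [RealRooted, hne, topChainPolynomial_ne_zero, false_or]
  constructor
  · intro h y hy
    have hk := key y
    rw [hy, mul_zero, mul_eq_zero] at hk
    rcases hk with rfl | hk
    · simp
    by_cases hy1 : 1 + y = 0
    · rw [eq_neg_of_add_eq_zero_right hy1]
      simp
    have hsub : 1 - y / (1 + y) = 1 / (1 + y) := by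
      field_simp
      ring
    have hdiv : y / (1 + y) / (1 - y / (1 + y)) = y := by
      rw [hsub]
      field_simp
    have hroot := aeval_hPolynomial (P := P) (y / (1 + y)) (by rw [hsub]; simpa using hy1)
    rw [hdiv, hk, mul_zero] at hroot
    obtain ⟨r, hr⟩ := Complex.im_eq_zero_iff_exists_ofReal.1 (h _ hroot)
    rw [← hr] at hdiv
    exact Complex.im_eq_zero_iff_exists_ofReal.2 ⟨r / (1 - r), by rw [← hdiv]; push_cast; rfl⟩
  · intro h z hz
    have hz1 : 1 - z ≠ 0 := by
      intro h0
      rw [← sub_eq_zero.1 h0, ← map_one (algebraMap ℝ ℂ), aeval_algebraMap_apply] at hz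
      exact hPolynomial_eval_one_ne_zero (P := P) (by simpa [aeval_def] using hz)
    rw [aeval_hPolynomial z hz1, mul_eq_zero] at hz
    have hk := key (z / (1 - z))
    rw [hz.resolve_left (pow_ne_zero _ hz1), mul_zero] at hk
    have hadd : 1 + z / (1 - z) = 1 / (1 - z) := by
      field_simp
      ring
    have hroot := (mul_eq_zero.1 hk.symm).resolve_left (by rw [hadd]; simpa using hz1)
    obtain ⟨r, hr⟩ := Complex.im_eq_zero_iff_exists_ofReal.1 (h _ hroot)
    have hz' : z = z / (1 - z) / (1 + z / (1 - z)) := by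
      rw [hadd]
      field_simp
    rw [← hr] at hz'
    exact Complex.im_eq_zero_iff_exists_ofReal.2 ⟨r / (1 + r), by rw [hz']; push_cast; rfl⟩

end HPolynomial

theorem RealRooted.mul {f g : ℝ[X]} (hf : RealRooted f) (hg : RealRooted g) :
    RealRooted (f * g) := by
  rcases hf with rfl | hf
  · exact Or.inl (zero_mul _)
  rcases hg with rfl | hg
  · exact Or.inl (mul_zero _)
  refine Or.inr fun z hz => ?_
  rw [map_mul, mul_eq_zero] at hz
  exact hz.elim (hf z) (hg z)

/-- By the Gauss–Lucas theorem, the derivative of a real-rooted polynomial is real-rooted. -/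
theorem RealRooted.derivative {f : ℝ[X]} (hf : RealRooted f) :
    RealRooted (Polynomial.derivative f) := by
  rcases hf with rfl | hf
  · exact Or.inl (by simp)
  by_cases h0 : Polynomial.derivative f = 0
  · exact Or.inl h0
  refine Or.inr fun z hz => ?_
  have hinj : Function.Injective (algebraMap ℝ ℂ) := (algebraMap ℝ ℂ).injective
  have hdeg : 0 < (f.map (algebraMap ℝ ℂ)).degree := by
    rw [degree_map]
    by_contra hd
    rw [eq_C_of_degree_le_zero (not_lt.1 hd)] at h0
    simp at h0
  have hmem := rootSet_derivative_subset_convexHull_rootSet hdeg (a := z) (by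
    rw [derivative_map, mem_rootSet]
    refine ⟨(Polynomial.map_ne_zero_iff hinj).2 h0, ?_⟩
    rwa [aeval_map_algebraMap])
  have hconv : Convex ℝ {w : ℂ | w.im = 0} :=
    (LinearMap.ker Complex.imLm).convex
  refine convexHull_min (fun w hw => hf w ?_) hconv hmem
  simpa only [aeval_map_algebraMap] using (mem_rootSet.1 hw).2

/-! ### Flats of a matroid with a coloop -/

section Matroid

variable {α : Type*} {M : Matroid α} {e : α}

theorem Matroid.IsFlat.sdiff_delete {F : Set α} (hF : M.IsFlat F) :
    (M.delete {e}).IsFlat (F \ {e}) := by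
  rw [Matroid.isFlat_iff_closure_eq, Matroid.delete_closure_eq, sdiff_idem]
  refine subset_antisymm (Set.sdiff_subset_sdiff_left ?_) (Set.sdiff_subset_iff.2 ?_)
  · exact (M.closure_subset_closure Set.sdiff_subset).trans hF.closure.subset
  · intro x hx
    by_cases hxe : x = e
    · exact Or.inl hxe
    · exact Or.inr ⟨M.subset_closure _ (Set.sdiff_subset.trans hF.subset_ground) ⟨hx, hxe⟩, hxe⟩

theorem Matroid.IsFlat.notMem_of_delete {G : Set α} (hG : (M.delete {e}).IsFlat G) : e ∉ G :=
  fun h => (hG.subset_ground h).2 rfl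

theorem Matroid.IsColoop.isFlat_of_delete (he : M.IsColoop e) {G : Set α}
    (hG : (M.delete {e}).IsFlat G) : M.IsFlat G := by
  have h := hG.closure
  have heG := hG.notMem_of_delete
  rw [Matroid.delete_closure_eq_of_disjoint _ (by simpa using heG),
    Set.sdiff_singleton_eq_self (he.notMem_closure_of_notMem heG)] at h
  exact Matroid.isFlat_iff_closure_eq.2 h

theorem Matroid.IsColoop.isFlat_insert_of_delete (he : M.IsColoop e) {G : Set α}
    (hG : (M.delete {e}).IsFlat G) : M.IsFlat (insert e G) := by
  rw [Matroid.isFlat_iff_closure_eq, Matroid.closure_insert_isColoop_eq _ he,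
    (he.isFlat_of_delete hG).closure]

open scoped Classical in
/-- The lattice of flats of a matroid with a coloop `e` is the product of the lattice of flats of
the deletion of `e` with a two-element chain. -/
noncomputable def Matroid.IsColoop.flatsOrderIso (he : M.IsColoop e) :
    LatticeOfFlats M ≃o LatticeOfFlats (M.delete {e}) × Bool where
  toFun F := (⟨F.1 \ {e}, Matroid.IsFlat.sdiff_delete F.2⟩, decide (e ∈ F.1))
  invFun G := if G.2 then ⟨insert e G.1.1, he.isFlat_insert_of_delete G.1.2⟩
    else ⟨G.1.1, he.isFlat_of_delete G.1.2⟩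
  left_inv F := by
    by_cases h : e ∈ F.1
    · simp [h]
    · simp [h]
  right_inv := by
    rintro ⟨G, b⟩
    have := G.2.notMem_of_delete
    cases b <;> simp [this]
  map_rel_iff' := by
    rintro ⟨F, hF⟩ ⟨G, hG⟩
    simp only [Equiv.coe_fn_mk, Prod.mk_le_mk, Subtype.mk_le_mk,
      Bool.le_iff_imp, decide_eq_true_eq]
    constructor
    · rintro ⟨h1, h2⟩ x hx
      by_cases hxe : x = e
      · exact hxe ▸ h2 (hxe ▸ hx)
      · exact (h1 ⟨hx, hxe⟩).1
    · exact fun h => ⟨Set.sdiff_subset_sdiff_left h, fun he => h he⟩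

theorem finite_latticeOfFlats (M : Matroid α) [M.Finite] : Finite (LatticeOfFlats M) :=
  (M.ground_finite.finite_subsets.subset fun _ hF => Matroid.IsFlat.subset_ground hF).to_subtype

theorem isTop_ground_latticeOfFlats (M : Matroid α) :
    IsTop (⟨M.E, M.ground_isFlat⟩ : LatticeOfFlats M) :=
  fun F => F.2.subset_ground

theorem finite_of_finite_delete_singleton (h : (M.delete {e}).Finite) :
    M.Finite :=
  ⟨(h.ground_finite.insert e).subset fun x hx => by
    by_cases hxe : x = e
    · exact Or.inl hxe
    · exact Or.inr ⟨hx, hxe⟩⟩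

theorem Matroid.IsColoop.realRooted_hPolynomial (he : M.IsColoop e) [M.Finite]
    [(M.delete {e}).Finite] (h : RealRooted (hPolynomial (LatticeOfFlats (M.delete {e})))) :
    RealRooted (hPolynomial (LatticeOfFlats M)) := by
  have := finite_latticeOfFlats M
  have := finite_latticeOfFlats (M.delete {e})
  have := Fintype.ofFinite (LatticeOfFlats M)
  have := Fintype.ofFinite (LatticeOfFlats (M.delete {e}))
  rw [realRooted_hPolynomial_iff (isTop_ground_latticeOfFlats _)] at h ⊢
  -- The top flat contains `e`, so it lands in the `true` layer, where the derivative formula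
  -- applies.
  have hE : he.flatsOrderIso ⟨M.E, M.ground_isFlat⟩ =
      (⟨(M.delete {e}).E, Matroid.ground_isFlat _⟩, true) := by
    simp [Matroid.IsColoop.flatsOrderIso, he.mem_ground]
  rw [← topChainPolynomial_orderIso he.flatsOrderIso, hE, topChainPolynomial_prod_bool_true]
  refine (RealRooted.mul (Or.inr fun z hz => ?_) (Or.inr fun z hz => ?_)).mul h.derivative
  · simp_all
  · rw [map_add, map_one, aeval_X] at hz
    rw [eq_neg_of_add_eq_zero_right hz]
    simp

end Matroid

/-- If `M` is a (finite) matroid whose lattice of flats has a real-rooted `h`-polynomial and `M'`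
is obtained from `M` by successively adding finitely many coloops, then the `h`-polynomial of the
lattice of flats of `M'` is real-rooted. -/
theorem corollary5p4 {α : Type*} (M M' : Matroid α) [M.Finite]
    (hM : RealRooted (hPolynomial (LatticeOfFlats M)))
    (hM' : Relation.ReflTransGen AddsColoop M M') :
    RealRooted (hPolynomial (LatticeOfFlats M')) := by
  -- Finiteness must travel through the induction, since each step needs finite lattices.
  suffices h : M'.Finite ∧ RealRooted (hPolynomial (LatticeOfFlats M')) from h.2
  induction hM' with
  | refl => exact ⟨inferInstance, hM⟩
  | tail _ hstep ih =>
    obtain ⟨e, he, rfl⟩ := hstep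
    have := ih.1
    have := finite_of_finite_delete_singleton ih.1
    exact ⟨this, he.realRooted_hPolynomial ih.2⟩
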